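/- Write $[n]=\{1,\dots,n\}$ and $\mathbb T=\mathbb R\cup\{\infty\}$ (min-plus convention, $a\oplus b=\min(a,b)$, $a\odot b=a+b$; topology homeomorphic to $(-\infty,0]$). For a finite set $E$ let $\mathbb P(\mathbb T^{E})=(\mathbb T^{E}\setminus\{(\infty,\dots,\infty)\})/\mathbb R\mathbf 1$, with the quotient topology. A valuated matroid $\mu$ with underlying matroid $M$ on a ground set $E\subseteq[n]$ is a function $\mu:\mathcal B(M)\to\mathbb R$ on the bases such that for all bases $B,B'$ and $i\in B\setminus B'$ there is $j\in B'\setminus B$ with $\mu(B)+\mu(B')\ge\mu(B\setminus i\cup j)+\mu(B'\setminus j\cup i)$, where $\mu(I)=\infty$ if $I$ is not a basis. If $M$ has rank $r$: - The valuated circuits of $\mu$ are the vectors $\mathbf C_\mu(S)\neq(\infty,\dots,\infty)$, for $S\subseteq E$ with $|S|=r+1$, where $C_\mu(S)_i=\mu(S\setminus i)$ for $i\in S$ and $C_\mu(S)_i=\infty$ otherwise. The dual $\mu^*$ is given by $\mu^*(E\setminus B)=\mu(B)$; the valuated cocircuits of $\mu$ are the valuated circuits of $\mu^*$. - For $S\subseteq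 E$, the contraction $\mu/S$, with underlying matroid $M/S$, is $A\mapsto\mu(A\cup J)$ for a fixed basis $J$ of $M|S$; the restriction $\mu|_S$, with underlying matroid $M|S$, is $A\mapsto\mu(A\cup J)$ for a fixed basis $J$ of $M/S$. Both are independent of $J$ up to an additive constant. - A minimum all of whose terms are $\infty$ is by convention achieved at least twice. The tropical linear space $\operatorname{trop}(\mu)\subseteq\mathbb R^{E}/\mathbb R\mathbf 1$ is the set of $\overline{\mathbf u}$ such that for every valuated circuit $\mathbf C$ of $\mu$ the minimum among $\{C_i+u_i\}_{i\in E}$ is achieved at least twice. - If $E=[n]$ and $\overline{\mathbf u}\in\mathbb P(\mathbb T^{[n]})$ has a representative $\mathbf u=\mathbf u'\times\{\infty\}^{[n]\setminus S}$ with $\emptyset\ne S\subseteq[n]$ and $\mathbf u'\in\mathbb R^S$, let $\Delta_\mu^{\overline{\mathbf u}}$ be the set of bases $B$ of $M|S$ that minimize $\sum_{i\in B}u'_i+\mu|_S(B)$ (the face, dual to $\overline{\mathbf u}$, of the coherent subdivision induced by $\mu|_S$). **Theorem.** Let $\mu$ be a valuated matroid on $[n]$, whose underlying matroid may have loops, and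 let $\ell\subseteq[n]$ be its set of loops. The following five subsets of $\mathbb P(\mathbb T^{[n]})$ coincide: (i) the projective tropical linear space $\overline{\operatorname{trop}}(\mu)=\bigcup_{\emptyset\subseteq S\subsetneq[n]}\big(\operatorname{trop}(\mu/S)\times\{\infty\}^S\big)$; (ii) the projective tropical prevariety of the valuated circuits of $\mu$, i.e. the set of $\overline{\mathbf u}\in\mathbb P(\mathbb T^{[n]})$ such that for every valuated circuit $\mathbf C$ of $\mu$ the minimum among $\{C_i+u_i\}_{i\in[n]}$ is achieved at least twice; (iii) the union of the coloopless cells of the closure of the dual complex of $\mu^*$ in $\mathbb P(\mathbb T^{[n]})$, i.e. the set of $\overline{\mathbf u}\in\mathbb P(\mathbb T^{[n]})$ such that $\Delta_{\mu^*}^{\overline{\mathbf u}}$ is the set of bases of a coloopless matroid on the ground set $\{i : u_i\neq\infty\}$; (iv) the tropical span of the valuated cocircuits of $\mu$, i.e. the set of images in $\mathbb P(\mathbb T^{[n]})$ of the vectors $(a_1\odot\mathbf C^*_1)\oplus\cdots\oplus(a_m\odot\mathbf C^*_m)$ with valuated cocircuits $\mathbf C^*_k$ of $\mu$ and $a_k\in\mathbb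 R$; (v) the closure of $\operatorname{trop}(\mu/\ell)\times\{\infty\}^\ell$ inside $\mathbb P(\mathbb T^{[n]})$, where this product is empty if $\ell=[n]$. -/

import Mathlib

open Set
open scoped Matroid

/-! ### Tropical projective space and its torus strata -/

/-- Two vectors of `𝕋^α`, where `𝕋 = ℝ ∪ {∞}`, are identified if they differ by a real multiple of
the all-one vector. The all-infinity vector is excluded. -/
def tropSetoid (α : Type*) : Setoid {u : α → WithTop ℝ // u ≠ ⊤} where
  r u v := ∃ c : ℝ, ∀ i, v.1 i = u.1 i + (c : WithTop ℝ)
  iseqv :=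
    { refl := fun u => ⟨0, fun i => by simp⟩
      symm := by
        rintro u v ⟨c, hc⟩
        refine ⟨-c, fun i => ?_⟩
        rw [hc i, add_assoc, ← WithTop.coe_add]
        simp
      trans := by
        rintro u v w ⟨c, hc⟩ ⟨d, hd⟩
        refine ⟨c + d, fun i => ?_⟩
        rw [hd i, hc i, add_assoc, ← WithTop.coe_add] }

/-- The tropical projective space `ℙ(𝕋^α)`. -/
def TropProj (α : Type*) : Type _ := Quotient (tropSetoid α)

/-- The quotient topology; `𝕋 = WithTop ℝ` has the order topology, `𝕋^α` the product topology. -/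
instance instTopologicalSpaceTropProj (α : Type*) : TopologicalSpace (TropProj α) :=
  inferInstanceAs (TopologicalSpace (Quotient (tropSetoid α)))

/-- The image in `ℙ(𝕋^α)` of a vector which is not `(∞, …, ∞)`. -/
def TropProj.mk {α : Type*} (v : α → WithTop ℝ) (hv : v ≠ ⊤) : TropProj α :=
  Quotient.mk (tropSetoid α) ⟨v, hv⟩

/-- `p` is the image in `ℙ(𝕋^α)` of the vector `v` (in particular `v` is not `(∞, …, ∞)`). -/
def TropProj.IsRep {α : Type*} (p : TropProj α) (v : α → WithTop ℝ) : Prop :=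
  ∃ hv : v ≠ ⊤, p = TropProj.mk v hv

/-- The torus `ℝ^E / ℝ𝟏`. -/
abbrev TropTorus {α : Type*} (E : Set α) : Type _ :=
  (E → ℝ) ⧸ Submodule.span ℝ {(1 : E → ℝ)}

open Classical in
/-- The vector `u × {∞}^{α ∖ E}`, for `u ∈ ℝ^E`. -/
noncomputable def extendTop {α : Type*} {E : Set α} (u : E → ℝ) : α → WithTop ℝ :=
  fun i => if h : i ∈ E then ((u ⟨i, h⟩ : ℝ) : WithTop ℝ) else ⊤

/-- `X × {∞}^{α ∖ E}` as a subset of `ℙ(𝕋^α)`, for `X ⊆ ℝ^E / ℝ𝟏`. It lies in the stratum of points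
with support `E`, and is empty if `E` is empty, as `(∞, …, ∞)` gives no point of `ℙ(𝕋^α)`. -/
def timesInfty {α : Type*} {E : Set α} (X : Set (TropTorus E)) : Set (TropProj α) :=
  {p | ∃ u : E → ℝ, Submodule.Quotient.mk u ∈ X ∧ p.IsRep (extendTop u)}

/-- The minimum of the values of `f` is achieved at least twice, which by convention is also the
case if all the values are `∞`. -/
def MinTwice {α : Type*} (f : α → WithTop ℝ) : Prop :=
  (∀ i, f i = ⊤) ∨ ∃ i j, i ≠ j ∧ f i = f j ∧ ∀ k, f i ≤ f k

/-- The projective tropical hypersurface of the linear tropical polynomial `⨁ C_i ⊙ x_i`. -/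
def tropHyperplane {α : Type*} (C : α → WithTop ℝ) : Set (TropProj α) :=
  {p | ∃ v, p.IsRep v ∧ MinTwice fun i => C i + v i}

/-- The tropical span of a set of vectors of `𝕋^α`, as a subset of `ℙ(𝕋^α)`: the images of the
vectors `(a₁ ⊙ C₁) ⊕ ⋯ ⊕ (aₘ ⊙ Cₘ)` with real coefficients `aₖ`. -/
def tropSpan {α : Type*} (𝒞 : Set (α → WithTop ℝ)) : Set (TropProj α) :=
  {p | ∃ (m : ℕ) (C : Fin m → α → WithTop ℝ) (a : Fin m → ℝ), (∀ k, C k ∈ 𝒞) ∧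
    p.IsRep fun i => Finset.univ.inf fun k => (a k : WithTop ℝ) + C k i}

/-! ### Valuated matroids -/

/-- A valuated matroid: a matroid with a real valued function on its bases that satisfies the
exchange inequality. The function is extended by `∞` to the sets which are not bases. -/
structure ValuatedMatroid (α : Type*) where
  /-- the underlying matroid -/
  toMatroid : Matroid α
  /-- the valuation -/
  val : Set α → WithTop ℝ
  val_ne_top_iff : ∀ B, val B ≠ ⊤ ↔ toMatroid.IsBase B
  exchange : ∀ B B', toMatroid.IsBase B → toMatroid.IsBase B' → ∀ i ∈ B \ B', ∃ j ∈ B' \ B,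
    val (insert j (B \ {i})) + val (insert i (B' \ {j})) ≤ val B + val B'

namespace ValuatedMatroid

variable {α : Type*}

theorem contract_isBase_iff {M : Matroid α} {S J A : Set α} (hJ : M.IsBasis' J S) :
    (M ／ S).IsBase A ↔ M.IsBase (A ∪ J) ∧ Disjoint A S := by
  constructor
  · intro h
    obtain ⟨hi, hd⟩ := hJ.contract_indep_iff.1 h.indep
    have hd := hd.symm
    refine ⟨?_, hd⟩
    obtain ⟨B, hB, hAB⟩ := hi.exists_isBase_superset
    have hBJ : B = (B \ J) ∪ J :=
      (sdiff_union_of_subset (subset_union_right.trans hAB)).symm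
    have hdis : Disjoint (B \ J) S := by
      rw [Set.disjoint_left]
      rintro x ⟨hxB, hxJ⟩ hxS
      exact hxJ (hJ.mem_of_insert_indep hxS
        (hB.indep.subset (insert_subset hxB (subset_union_right.trans hAB))))
    have hind : (M ／ S).Indep (B \ J) :=
      hJ.contract_indep_iff.2 ⟨hBJ ▸ hB.indep, hdis.symm⟩
    have hAJ : Disjoint A J := hd.mono_right hJ.subset
    have hsub : A ⊆ B \ J := fun x hx => ⟨hAB (Or.inl hx), Set.disjoint_left.1 hAJ hx⟩
    rw [h.eq_of_subset_indep hind hsub, ← hBJ]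
    exact hB
  · rintro ⟨h, hd⟩
    refine Matroid.isBase_iff_maximal_indep.2
      ⟨hJ.contract_indep_iff.2 ⟨h.indep, hd.symm⟩, fun K hK hAK x hx => ?_⟩
    obtain ⟨hKi, hKd⟩ := hJ.contract_indep_iff.1 hK
    have := h.eq_of_subset_indep hKi (union_subset_union_left J hAK)
    have hx' : x ∈ A ∪ J := this ▸ Or.inl hx
    exact hx'.resolve_right fun hxJ => Set.disjoint_left.1 hKd (hJ.subset hxJ) hx

theorem restrict_isBase_iff {M : Matroid α} {S J I : Set α} (hJ : (M ／ S).IsBase J) :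
    (M ↾ S).IsBase I ↔ M.IsBase (I ∪ J) ∧ I ⊆ S := by
  rw [Matroid.isBase_restrict_iff']
  constructor
  · intro hI
    exact ⟨union_comm J I ▸ ((contract_isBase_iff hI).1 hJ).1, hI.subset⟩
  · rintro ⟨hb, hIS⟩
    obtain ⟨I', hI', hII'⟩ := (hb.indep.subset subset_union_left).subset_isBasis'_of_subset hIS
    obtain ⟨hb', hd⟩ := (contract_isBase_iff hI').1 hJ
    have heq : I ∪ J = I' ∪ J :=
      hb.eq_of_subset_isBase (union_comm J I' ▸ hb') (union_subset_union_left J hII')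
    have : I = I' := by
      refine hII'.antisymm fun x hx => ?_
      have hx' : x ∈ I ∪ J := heq ▸ Or.inl hx
      exact hx'.resolve_right fun hxJ => Set.disjoint_left.1 hd hxJ (hI'.subset hx)
    exact this ▸ hI'

/-- The exchange inequality for the sets `A ∪ J` with `J` fixed. -/
theorem exchange_union (μ : ValuatedMatroid α) {J A A' : Set α}
    (hA : μ.toMatroid.IsBase (A ∪ J)) (hA' : μ.toMatroid.IsBase (A' ∪ J)) {i : α}
    (hi : i ∈ A \ A') (hiJ : i ∉ J) :
    ∃ j ∈ A' \ A, j ∉ J ∧ μ.val (insert j (A \ {i}) ∪ J) + μ.val (insert i (A' \ {j}) ∪ J) ≤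
      μ.val (A ∪ J) + μ.val (A' ∪ J) := by
  obtain ⟨j, ⟨hj1, hj2⟩, h⟩ := μ.exchange _ _ hA hA' i
    ⟨Or.inl hi.1, fun h => h.elim hi.2 hiJ⟩
  have hjJ : j ∉ J := fun h => hj2 (Or.inr h)
  refine ⟨j, ⟨hj1.resolve_right hjJ, fun h => hj2 (Or.inl h)⟩, hjJ, ?_⟩
  have e1 : insert j (A \ {i}) ∪ J = insert j ((A ∪ J) \ {i}) := by
    rw [insert_union, union_sdiff_distrib, sdiff_singleton_eq_self hiJ]
  have e2 : insert i (A' \ {j}) ∪ J = insert i ((A' ∪ J) \ {j}) := by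
    rw [insert_union, union_sdiff_distrib, sdiff_singleton_eq_self hjJ]
  rw [e1, e2]
  exact h

open Classical in
/-- The dual valuated matroid, `μ*(E ∖ B) = μ(B)`. -/
noncomputable def dual (μ : ValuatedMatroid α) : ValuatedMatroid α where
  toMatroid := μ.toMatroid✶
  val B := if B ⊆ μ.toMatroid.E then μ.val (μ.toMatroid.E \ B) else ⊤
  val_ne_top_iff B := by
    rw [Matroid.dual_isBase_iff', ← μ.val_ne_top_iff]
    split_ifs with h <;> simp [h]
  exchange B B' hB hB' i hi := by
    obtain ⟨hb, hBE⟩ := Matroid.dual_isBase_iff'.1 hB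
    obtain ⟨hb', hBE'⟩ := Matroid.dual_isBase_iff'.1 hB'
    obtain ⟨j, ⟨⟨hjE, hjB⟩, hj⟩, h⟩ := μ.exchange _ _ hb' hb i
      ⟨⟨hBE hi.1, hi.2⟩, fun h => h.2 hi.1⟩
    have hjB' : j ∈ B' := by
      by_contra hc
      exact hj ⟨hjE, hc⟩
    have hij : i ≠ j := fun h => hjB (h ▸ hi.1)
    refine ⟨j, ⟨hjB', hjB⟩, ?_⟩
    have e1 : μ.toMatroid.E \ insert j (B \ {i}) = insert i ((μ.toMatroid.E \ B) \ {j}) := by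
      ext x
      have := hBE hi.1
      simp only [mem_sdiff, mem_insert_iff, mem_singleton_iff]
      by_cases hxi : x = i
      · subst hxi; simp [hij, this]
      · simp only [hxi, not_false_eq_true, and_true, false_or]; tauto
    have e2 : μ.toMatroid.E \ insert i (B' \ {j}) = insert j ((μ.toMatroid.E \ B') \ {i}) := by
      ext x
      simp only [mem_sdiff, mem_insert_iff, mem_singleton_iff]
      by_cases hxj : x = j
      · subst hxj; simp [hij.symm, hjE]
      · simp only [hxj, not_false_eq_true, and_true, false_or]; tauto
    rw [if_pos (insert_subset hjE (sdiff_subset.trans hBE)),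
      if_pos (insert_subset (hBE hi.1) (sdiff_subset.trans hBE')), if_pos hBE, if_pos hBE', e1, e2]
    rw [add_comm, add_comm (μ.val (μ.toMatroid.E \ B))]
    exact h

/-- A chosen basis of `S` (a base of the restriction to `S`). -/
noncomputable def basisOf (M : Matroid α) (S : Set α) : Set α := (M.exists_isBasis' S).choose

theorem basisOf_spec (M : Matroid α) (S : Set α) : M.IsBasis' (basisOf M S) S :=
  (M.exists_isBasis' S).choose_spec

/-- A chosen base of the contraction by `S`. -/
noncomputable def cobasisOf (M : Matroid α) (S : Set α) : Set α := (M ／ S).exists_isBase.choose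

theorem cobasisOf_spec (M : Matroid α) (S : Set α) : (M ／ S).IsBase (cobasisOf M S) :=
  (M ／ S).exists_isBase.choose_spec

open Classical in
/-- The contraction `μ/S`, on the ground set `E ∖ S`: `(μ/S)(A) = μ(A ∪ J)` for a fixed basis `J`
of `S`. Up to an additive constant it does not depend on `J`. -/
noncomputable def contract (μ : ValuatedMatroid α) (S : Set α) : ValuatedMatroid α where
  toMatroid := μ.toMatroid ／ S
  val A := if Disjoint A S then μ.val (A ∪ basisOf μ.toMatroid S) else ⊤
  val_ne_top_iff A := by
    rw [contract_isBase_iff (basisOf_spec _ _), ← μ.val_ne_top_iff]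
    split_ifs with h <;> simp [h]
  exchange A A' hA hA' i hi := by
    have hJ := basisOf_spec μ.toMatroid S
    obtain ⟨hb, hd⟩ := (contract_isBase_iff hJ).1 hA
    obtain ⟨hb', hd'⟩ := (contract_isBase_iff hJ).1 hA'
    obtain ⟨j, hj, -, h⟩ := μ.exchange_union hb hb' hi
      (fun h => Set.disjoint_left.1 hd hi.1 (hJ.subset h))
    refine ⟨j, hj, ?_⟩
    have hdi : Disjoint (insert j (A \ {i})) S :=
      disjoint_insert_left.2 ⟨Set.disjoint_left.1 hd' hj.1, hd.mono_left sdiff_subset⟩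
    have hdj : Disjoint (insert i (A' \ {j})) S :=
      disjoint_insert_left.2 ⟨Set.disjoint_left.1 hd hi.1, hd'.mono_left sdiff_subset⟩
    rw [if_pos hdi, if_pos hdj, if_pos hd, if_pos hd']
    exact h

open Classical in
/-- The restriction `μ|S`, on the ground set `S`: `(μ|S)(A) = μ(A ∪ J)` for a fixed base `J` of the
contraction by `S`. Up to an additive constant it does not depend on `J`. -/
noncomputable def restrict (μ : ValuatedMatroid α) (S : Set α) : ValuatedMatroid α where
  toMatroid := μ.toMatroid ↾ S
  val A := if A ⊆ S then μ.val (A ∪ cobasisOf μ.toMatroid S) else ⊤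
  val_ne_top_iff A := by
    rw [restrict_isBase_iff (cobasisOf_spec _ _), ← μ.val_ne_top_iff]
    split_ifs with h <;> simp [h]
  exchange A A' hA hA' i hi := by
    have hJ := cobasisOf_spec μ.toMatroid S
    obtain ⟨hb, hd⟩ := (restrict_isBase_iff hJ).1 hA
    obtain ⟨hb', hd'⟩ := (restrict_isBase_iff hJ).1 hA'
    have hJS : Disjoint S (cobasisOf μ.toMatroid S) :=
      (Set.disjoint_left.2 fun x hx hxS => (hJ.subset_ground hx).2 hxS).symm
    obtain ⟨j, hj, -, h⟩ := μ.exchange_union hb hb' hi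
      (fun h => Set.disjoint_left.1 hJS (hd hi.1) h)
    refine ⟨j, hj, ?_⟩
    have hdi : insert j (A \ {i}) ⊆ S := insert_subset (hd' hj.1) (sdiff_subset.trans hd)
    have hdj : insert i (A' \ {j}) ⊆ S := insert_subset (hd hi.1) (sdiff_subset.trans hd')
    rw [if_pos hdi, if_pos hdj, if_pos hd, if_pos hd']
    exact h

open Classical in
/-- The vector `C_μ(S) ∈ 𝕋^α`: `μ(S ∖ i)` at `i ∈ S`, and `∞` outside of `S`. -/
noncomputable def circuitVec (μ : ValuatedMatroid α) (S : Set α) : α → WithTop ℝ :=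
  fun i => if i ∈ S then μ.val (S \ {i}) else ⊤

/-- The valuated circuits: the vectors `C_μ(S)`, for `S` of size one more than the rank, which are
not `(∞, …, ∞)`. -/
def circuits (μ : ValuatedMatroid α) : Set (α → WithTop ℝ) :=
  {C | ∃ S ⊆ μ.toMatroid.E, S.encard = μ.toMatroid.eRank + 1 ∧ C = μ.circuitVec S} \ {⊤}

/-- The valuated cocircuits: the valuated circuits of the dual. -/
def cocircuits (μ : ValuatedMatroid α) : Set (α → WithTop ℝ) := μ.dual.circuits

/-- The tropical linear space `trop(μ) ⊆ ℝ^E / ℝ𝟏`: the tropical prevariety of the valuated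
circuits. The values `C_i + u_i` with `i` outside of `E` are `∞` and do not count. -/
def trop (μ : ValuatedMatroid α) : Set (TropTorus μ.toMatroid.E) :=
  Submodule.Quotient.mk ''
    {u : μ.toMatroid.E → ℝ | ∀ C ∈ μ.circuits, MinTwice fun i => C i + extendTop u i}

/-- The projective tropical prevariety of the valuated circuits. -/
def circuitPrevariety (μ : ValuatedMatroid α) : Set (TropProj α) :=
  ⋂ C ∈ μ.circuits, tropHyperplane C

open Classical in
/-- The inner product of `u ∈ ℝ^E` with the indicator vector of `B ⊆ E`. -/
noncomputable def pairing [Fintype α] {E : Set α} (u : E → ℝ) (B : Set α) : ℝ :=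
  ∑ i : E, if (i : α) ∈ B then u i else 0

/-- The face of the coherent subdivision induced by `μ` that corresponds to `u ∈ ℝ^E`: the bases
`B` that minimize `⟨u, e_B⟩ + μ(B)`. -/
def face [Fintype α] (μ : ValuatedMatroid α) (u : μ.toMatroid.E → ℝ) : Set (Set α) :=
  {B | μ.toMatroid.IsBase B ∧ ∀ B', μ.toMatroid.IsBase B' →
    (pairing u B : WithTop ℝ) + μ.val B ≤ (pairing u B' : WithTop ℝ) + μ.val B'}

/-- `F` is the set of bases of a coloopless matroid on the ground set `S`. -/
def IsColooplessBaseSet (S : Set α) (F : Set (Set α)) : Prop :=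
  ∃ N : Matroid α, N.E = S ∧ (∀ B, N.IsBase B ↔ B ∈ F) ∧ ∀ e, ¬ N.IsColoop e

/-- The union of the coloopless cells of the closure in `ℙ(𝕋^α)` of the dual complex of `μ`. The
face at the point with representative `u × {∞}^{α ∖ S}`, `u ∈ ℝ^S`, is the face of the restriction
`μ|S` at `u`. -/
def colooplessCells [Fintype α] (μ : ValuatedMatroid α) : Set (TropProj α) :=
  {p | ∃ (S : Set α) (u : S → ℝ), p.IsRep (extendTop u) ∧
    IsColooplessBaseSet S ((μ.restrict S).face u)}

/-- The projective tropical linear space, the union of the sets `trop(μ/S) × {∞}^S` over the proper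
subsets `S` of the ground set. -/
def projTrop (μ : ValuatedMatroid α) : Set (TropProj α) :=
  ⋃ S ∈ {S : Set α | S ⊂ μ.toMatroid.E}, timesInfty (μ.contract S).trop

end ValuatedMatroid

/-! All five sets are compared with the circuit prevariety, by way of a criterion that mentions only
bases. Let `v` represent a point, let S be the set where `v` is infinite and J a basis of S. Give a
base B the weight μ(B) minus the sum of the finite coordinates of `v` over B. Then `v` is orthogonal
to all valuated circuits exactly when every finite coordinate of `v` lies in a base of least weight
among the bases containing J (`circuitOrthogonal_iff_minBasesCover`). One direction reads the
inequality off a fundamental circuit; the other is one exchange against a minimal base.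

The criterion gives each description. In the contraction by S, the circuits come from sets T ∪ J,
which is all the criterion needs. In the dual, complements of the minimal bases are the bases of the
dual cell, and covering a coordinate means that it is not a coloop. For the span, the fundamental
cocircuit of a minimal base, suitably scaled, lies above `v` and touches it at a chosen coordinate;
conversely, circuits and cocircuits are orthogonal by the exchange axiom. For the closure, take an
orthogonal `w` that is infinite only at loops: the vectors min(`v`, `w` + t) are orthogonal and
converge to `v`. -/

/-! ### Minima achieved at least twice. -/

section MinTwice

variable {α : Type*}

theorem MinTwice.exists_ne_le {f : α → WithTop ℝ} (h : MinTwice f) {i : α} (hi : f i ≠ ⊤) :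
    ∃ j, j ≠ i ∧ f j ≤ f i := by
  rcases h with h | ⟨a, b, hab, he, hle⟩
  · exact absurd (h i) hi
  · rcases eq_or_ne a i with rfl | ha
    · exact ⟨b, hab.symm, he ▸ le_rfl⟩
    · exact ⟨a, ha, hle i⟩

/-- Together with `MinTwice.exists_ne_le` this gives a local form of the condition, which a single
basis exchange can verify without locating the minimum. -/
theorem MinTwice.of_forall_exists_ne_le [Finite α] {f : α → WithTop ℝ}
    (h : ∀ i, f i ≠ ⊤ → ∃ j, j ≠ i ∧ f j ≤ f i) : MinTwice f := by
  by_cases hf : ∀ i, f i = ⊤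
  · exact Or.inl hf
  · push Not at hf
    obtain ⟨i₀, hi₀⟩ := hf
    have : Nonempty α := ⟨i₀⟩
    obtain ⟨i, hi⟩ := Finite.exists_min f
    obtain ⟨j, hji, hj⟩ := h i (ne_top_of_le_ne_top hi₀ (hi i₀))
    exact Or.inr ⟨i, j, hji.symm, le_antisymm (hi j) hj, hi⟩

theorem MinTwice.add_const {f : α → WithTop ℝ} (h : MinTwice f) (c : ℝ) :
    MinTwice fun i => f i + (c : WithTop ℝ) := by
  rcases h with h | ⟨a, b, hab, he, hle⟩
  · exact Or.inl fun i => by simp [h i]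
  · exact Or.inr ⟨a, b, hab, by simp only [he], fun k => add_le_add_left (hle k) _⟩

/-- At each index the infimum is attained by one of the vectors, and the competing index for that
vector still competes after passing to the infimum. -/
theorem MinTwice.add_inf [Finite α] {C : α → WithTop ℝ} {ι : Type*} {s : Finset ι}
    {v : ι → α → WithTop ℝ} (h : ∀ k ∈ s, MinTwice fun i => C i + v k i) :
    MinTwice fun i => C i + s.inf fun k => v k i := by
  refine .of_forall_exists_ne_le fun i hi => ?_
  have hs : s.Nonempty := by
    rw [Finset.nonempty_iff_ne_empty]
    rintro rfl
    simp at hi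
  obtain ⟨k, hk, hki⟩ := s.exists_mem_eq_inf hs fun k => v k i
  simp only [hki] at hi ⊢
  obtain ⟨j, hji, hj⟩ := (h k hk).exists_ne_le hi
  exact ⟨j, hji, (add_le_add_right (Finset.inf_le (f := fun k => v k j) hk) _).trans hj⟩

end MinTwice

/-! ### Translated valuations and bases of minimal weight. -/

namespace ValuatedMatroid

variable {α : Type*} (μ : ValuatedMatroid α)

/-- The real value of a valuated matroid at a base. -/
noncomputable def realVal (B : Set α) : ℝ := (μ.val B).untopD 0

variable {μ}

theorem coe_realVal {B : Set α} (hB : μ.toMatroid.IsBase B) :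
    (μ.realVal B : WithTop ℝ) = μ.val B := by
  obtain ⟨r, hr⟩ := WithTop.ne_top_iff_exists.1 ((μ.val_ne_top_iff B).2 hB)
  rw [realVal, ← hr]
  rfl

theorem sum_indicator_exchange [Fintype α] (w : α → ℝ) {B : Set α} {i j : α} (hi : i ∈ B)
    (hj : j ∉ B) :
    ∑ k, (insert j (B \ {i})).indicator w k = ∑ k, B.indicator w k - w i + w j := by
  classical
  have hp : ∀ k, (insert j (B \ {i})).indicator w k =
      B.indicator w k - (if k = i then w k else 0) + (if k = j then w k else 0) := by
    intro k
    by_cases hki : k = i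
    · subst hki
      have : k ≠ j := fun h => hj (h ▸ hi)
      simp [indicator, hi, this]
    · by_cases hkj : k = j
      · subst hkj
        simp [indicator, hj, hki]
      · simp [indicator, hki, hkj]
  simp [hp, Finset.sum_add_distrib, Finset.sum_sub_distrib]

variable (μ) in
/-- The value of a base for the valuation translated by `-w`. -/
noncomputable def weight [Fintype α] (w : α → ℝ) (B : Set α) : ℝ :=
  μ.realVal B - ∑ k, B.indicator w k

theorem weight_exchange_eq [Fintype α] (w : α → ℝ) {B : Set α} {i j : α} (hi : i ∈ B)
    (hj : j ∉ B) : μ.weight w (insert j (B \ {i})) =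
      μ.realVal (insert j (B \ {i})) - ∑ k, B.indicator w k + w i - w j := by
  rw [weight, sum_indicator_exchange w hi hj]
  ring

/-- The right side of the exchange inequality is finite, so both terms on the left are finite and
the exchanged sets are bases. -/
theorem exists_isBase_exchange {B B' : Set α} (hB : μ.toMatroid.IsBase B)
    (hB' : μ.toMatroid.IsBase B') {i : α} (hi : i ∈ B \ B') :
    ∃ j ∈ B' \ B, μ.toMatroid.IsBase (insert j (B \ {i})) ∧
      μ.toMatroid.IsBase (insert i (B' \ {j})) ∧
      μ.realVal (insert j (B \ {i})) + μ.realVal (insert i (B' \ {j})) ≤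
        μ.realVal B + μ.realVal B' := by
  obtain ⟨j, hj, h⟩ := μ.exchange B B' hB hB' i hi
  have hne : μ.val (insert j (B \ {i})) + μ.val (insert i (B' \ {j})) ≠ ⊤ := by
    refine ne_top_of_le_ne_top ?_ h
    rw [← coe_realVal hB, ← coe_realVal hB', ← WithTop.coe_add]
    exact WithTop.coe_ne_top
  obtain ⟨h1, h2⟩ := WithTop.add_ne_top.1 hne
  have h1 := (μ.val_ne_top_iff _).1 h1
  have h2 := (μ.val_ne_top_iff _).1 h2
  refine ⟨j, hj, h1, h2, ?_⟩
  rw [← coe_realVal hB, ← coe_realVal hB', ← coe_realVal h1, ← coe_realVal h2] at h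
  exact_mod_cast h

/-- The exchange moves `i` and `j` between the two bases, so the total of `w` over both is unchanged
and translation preserves the inequality. -/
theorem exists_isBase_weight_exchange [Fintype α] (w : α → ℝ) {B B' : Set α}
    (hB : μ.toMatroid.IsBase B) (hB' : μ.toMatroid.IsBase B') {i : α} (hi : i ∈ B \ B') :
    ∃ j ∈ B' \ B, μ.toMatroid.IsBase (insert j (B \ {i})) ∧
      μ.toMatroid.IsBase (insert i (B' \ {j})) ∧
      μ.weight w (insert j (B \ {i})) + μ.weight w (insert i (B' \ {j})) ≤
        μ.weight w B + μ.weight w B' := by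
  obtain ⟨j, hj, h1, h2, h⟩ := exists_isBase_exchange hB hB' hi
  refine ⟨j, hj, h1, h2, ?_⟩
  rw [weight_exchange_eq w hi.1 hj.2, weight_exchange_eq w hj.1 hi.2, weight, weight]
  linarith

/-- The real part of a vector of `𝕋^α`. -/
noncomputable def realPart (v : α → WithTop ℝ) (i : α) : ℝ := (v i).untopD 0

theorem coe_realPart {v : α → WithTop ℝ} {i : α} (h : v i ≠ ⊤) :
    (realPart v i : WithTop ℝ) = v i := by
  obtain ⟨r, hr⟩ := WithTop.ne_top_iff_exists.1 h
  rw [realPart, ← hr]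
  rfl

variable (μ) in
/-- `B` has the least weight among the bases that contain `J`. -/
def IsMinBase [Fintype α] (J : Set α) (w : α → ℝ) (B : Set α) : Prop :=
  μ.toMatroid.IsBase B ∧ J ⊆ B ∧
    ∀ B', μ.toMatroid.IsBase B' → J ⊆ B' → μ.weight w B ≤ μ.weight w B'

theorem exists_isMinBase [Fintype α] {J : Set α} (hJ : μ.toMatroid.Indep J) (w : α → ℝ) :
    ∃ B, μ.IsMinBase J w B := by
  obtain ⟨B₀, hB₀, hJB₀⟩ := hJ.exists_isBase_superset
  obtain ⟨B, hB, hmin⟩ := exists_min_image {B | μ.toMatroid.IsBase B ∧ J ⊆ B} (μ.weight w)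
    (toFinite _) ⟨B₀, hB₀, hJB₀⟩
  exact ⟨B, hB.1, hB.2, fun B' h h' => hmin B' ⟨h, h'⟩⟩

variable (μ) in
/-- Every finite coordinate of `v` lies in a base of minimal weight containing `J`. -/
def MinBasesCover [Fintype α] (J : Set α) (v : α → WithTop ℝ) : Prop :=
  ∀ i, v i ≠ ⊤ → ∃ B, μ.IsMinBase J (realPart v) B ∧ i ∈ B

theorem insert_sdiff_singleton_of_ne {B : Set α} {i j : α} (h : i ≠ j) :
    insert i B \ {j} = insert i (B \ {j}) := by
  rw [insert_sdiff_of_notMem _ (by simpa using h)]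

/-- If a minimal base B misses `i`, a second index c in the fundamental circuit of `i` satisfies μ(B
− c + i) + v_c ≤ μ(B) + v_i. This says that B − c + i is again minimal. Only fundamental circuits of
bases containing `J` are used, which are the ones that a contraction supplies. -/
theorem minBasesCover_of_minTwice [Fintype α] {J : Set α} {v : α → WithTop ℝ}
    (hJ : μ.toMatroid.Indep J) (hJv : ∀ i ∈ J, v i = ⊤)
    (h : ∀ B, μ.toMatroid.IsBase B → J ⊆ B → ∀ i ∉ B, v i ≠ ⊤ →
      MinTwice fun k => μ.circuitVec (insert i B) k + v k) :
    μ.MinBasesCover J v := by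
  intro i hi
  obtain ⟨B, hB⟩ := exists_isMinBase (μ := μ) hJ (realPart v)
  by_cases hiB : i ∈ B
  · exact ⟨B, hB, hiB⟩
  have hci : μ.circuitVec (insert i B) i = μ.val B := by
    rw [circuitVec, if_pos (mem_insert _ _), insert_sdiff_self_of_notMem hiB]
  have hne : μ.circuitVec (insert i B) i + v i ≠ ⊤ := by
    rw [hci]
    exact WithTop.add_ne_top.2 ⟨(μ.val_ne_top_iff _).2 hB.1, hi⟩
  obtain ⟨c, hci', hc⟩ := (h B hB.1 hB.2.1 i hiB hi).exists_ne_le hne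
  obtain ⟨hc1, hvc⟩ := WithTop.add_ne_top.1 (ne_top_of_le_ne_top hne hc)
  have hcB : c ∈ insert i B := by
    by_contra hcon
    exact hc1 (by rw [circuitVec, if_neg hcon])
  have hcB' : c ∈ B := hcB.resolve_left hci'
  have hcc : μ.circuitVec (insert i B) c = μ.val (insert i (B \ {c})) := by
    rw [circuitVec, if_pos hcB, insert_sdiff_singleton_of_ne hci'.symm]
  rw [hcc] at hc1
  have hB1 := (μ.val_ne_top_iff _).1 hc1
  -- `v` is infinite on `J` but finite at `c`, so deleting `c` does not touch `J`.
  have hJ1 : J ⊆ insert i (B \ {c}) := fun x hx =>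
    Or.inr ⟨hB.2.1 hx, fun hxc => hvc (hxc ▸ hJv x hx)⟩
  refine ⟨insert i (B \ {c}), ⟨hB1, hJ1, fun B' hB' hJB' => le_trans ?_ (hB.2.2 B' hB' hJB')⟩,
    mem_insert _ _⟩
  rw [hci, hcc, ← coe_realVal hB1, ← coe_realVal hB.1, ← coe_realPart hi, ← coe_realPart hvc] at hc
  have hc : μ.realVal (insert i (B \ {c})) + realPart v c ≤ μ.realVal B + realPart v i := by
    exact_mod_cast hc
  rw [weight_exchange_eq _ hcB' hiB, weight]
  linarith

/-- Exchange `i` between a minimal base B' through `i` and T − i. Since B' − i + j weighs at least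
as much as B', T − j weighs at most as much as T − i, which is the inequality between the entries at
`j` and `i`. -/
theorem MinBasesCover.minTwice [Fintype α] {J : Set α} {v : α → WithTop ℝ}
    (hJ : μ.toMatroid.IsBasis' J {i | v i = ⊤}) (h : μ.MinBasesCover J v) (T : Set α) :
    MinTwice fun k => μ.circuitVec T k + v k := by
  refine .of_forall_exists_ne_le fun i hi => ?_
  obtain ⟨hi1, hvi⟩ := WithTop.add_ne_top.1 hi
  have hiT : i ∈ T := by
    by_contra hcon
    exact hi1 (by rw [circuitVec, if_neg hcon])
  have hci : μ.circuitVec T i = μ.val (T \ {i}) := by rw [circuitVec, if_pos hiT]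
  rw [hci] at hi1
  have hB := (μ.val_ne_top_iff _).1 hi1
  obtain ⟨B', hB', hiB'⟩ := h i hvi
  obtain ⟨j, hj, h1, h2, hle⟩ := exists_isBase_weight_exchange (realPart v) hB'.1 hB
    (i := i) ⟨hiB', by simp⟩
  have hJ1 : J ⊆ insert j (B' \ {i}) := fun x hx =>
    Or.inr ⟨hB'.2.1 hx, fun hxi => hvi (hxi ▸ hJ.subset hx)⟩
  -- `J` is maximal independent in the infinite set, so an infinite `j` in a base containing `J`
  -- would lie in `J`, hence in B'. Finiteness matters because `realPart` replaces ∞ by 0.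
  have hvj : v j ≠ ⊤ := fun hvj =>
    hj.2 (hB'.2.1 (hJ.mem_of_insert_indep hvj
      (h1.indep.subset (insert_subset (mem_insert _ _) hJ1))))
  have hji : j ≠ i := hj.1.2
  have hmin := hB'.2.2 _ h1 hJ1
  refine ⟨j, hji, ?_⟩
  have hTj : insert i ((T \ {i}) \ {j}) = T \ {j} := by
    rw [← insert_sdiff_singleton_of_ne hji.symm, insert_sdiff_singleton, insert_eq_of_mem hiT]
  rw [weight_exchange_eq _ hj.1 (by simp)] at hle
  rw [hTj] at h2 hle
  rw [hci, circuitVec, if_pos hj.1.1, ← coe_realVal h2, ← coe_realVal hB, ← coe_realPart hvi,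
    ← coe_realPart hvj]
  simp only [weight] at hle hmin
  norm_cast
  linarith

/-! ### Orthogonality to the valuated circuits. -/

variable (μ) in
/-- `v` is tropically orthogonal to all valuated circuits of `μ`. -/
def CircuitOrthogonal (v : α → WithTop ℝ) : Prop :=
  ∀ C ∈ μ.circuits, MinTwice fun i => C i + v i

theorem circuitVec_insert_mem_circuits {B : Set α} (hB : μ.toMatroid.IsBase B) {i : α}
    (hiE : i ∈ μ.toMatroid.E) (hi : i ∉ B) : μ.circuitVec (insert i B) ∈ μ.circuits := by
  refine ⟨⟨insert i B, insert_subset hiE hB.subset_ground, ?_, rfl⟩, fun h => ?_⟩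
  · rw [encard_insert_of_notMem hi, hB.encard_eq_eRank]
  · have := congrFun h i
    rw [circuitVec, if_pos (mem_insert _ _), insert_sdiff_self_of_notMem hi] at this
    exact (μ.val_ne_top_iff _).2 hB this

theorem circuitOrthogonal_iff_minBasesCover [Fintype α] (hE : μ.toMatroid.E = univ) {J : Set α}
    {v : α → WithTop ℝ} (hJ : μ.toMatroid.IsBasis' J {i | v i = ⊤}) :
    μ.CircuitOrthogonal v ↔ μ.MinBasesCover J v := by
  constructor
  · exact fun h => minBasesCover_of_minTwice hJ.indep (fun i hi => hJ.subset hi)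
      fun B hB _ i hi _ => h _ (circuitVec_insert_mem_circuits hB (hE ▸ mem_univ i) hi)
  · rintro h C ⟨⟨T, -, -, rfl⟩, -⟩
    exact h.minTwice hJ T

/-- Dropping the cardinality condition on `T` spares rank computations for contractions. -/
theorem CircuitOrthogonal.minTwice [Fintype α] (hE : μ.toMatroid.E = univ) {v : α → WithTop ℝ}
    (h : μ.CircuitOrthogonal v) (T : Set α) : MinTwice fun k => μ.circuitVec T k + v k :=
  have hJ := basisOf_spec μ.toMatroid {i | v i = ⊤}
  ((circuitOrthogonal_iff_minBasesCover hE hJ).1 h).minTwice hJ T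

/-! ### Cocircuits -/

theorem dual_circuitVec (hE : μ.toMatroid.E = univ) (D : Set α) {i : α} (hi : i ∈ D) :
    μ.dual.circuitVec D i = μ.val (insert i Dᶜ) := by
  rw [circuitVec, if_pos hi]
  simp only [dual, hE, subset_univ, if_true]
  congr 1
  ext x
  by_cases hx : x = i <;> simp [hx]

/-- This is the exchange axiom for the bases Dᶜ + i and T − i: the sum at `i` is the sum of their
two values. -/
theorem minTwice_circuitVec_add_dual [Finite α] (hE : μ.toMatroid.E = univ) (T D : Set α) :
    MinTwice fun i => μ.circuitVec T i + μ.dual.circuitVec D i := by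
  refine .of_forall_exists_ne_le fun i hi => ?_
  obtain ⟨hi1, hi2⟩ := WithTop.add_ne_top.1 hi
  have hiT : i ∈ T := by
    by_contra hcon
    exact hi1 (by rw [circuitVec, if_neg hcon])
  have hiD : i ∈ D := by
    by_contra hcon
    exact hi2 (by rw [circuitVec, if_neg hcon])
  rw [circuitVec, if_pos hiT] at hi1 ⊢
  rw [dual_circuitVec hE D hiD] at hi2 ⊢
  have hB := (μ.val_ne_top_iff _).1 hi1
  have hB' := (μ.val_ne_top_iff _).1 hi2
  obtain ⟨j, hj, hle⟩ := μ.exchange _ _ hB' hB i ⟨mem_insert _ _, by simp⟩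
  have hji : j ≠ i := hj.1.2
  have hjD : j ∈ D := by
    by_contra hcon
    exact hj.2 (Or.inr hcon)
  refine ⟨j, hji, ?_⟩
  have e1 : insert j (insert i Dᶜ \ {i}) = insert j Dᶜ := by
    rw [insert_sdiff_self_of_notMem (by simpa using hiD)]
  have e2 : insert i ((T \ {i}) \ {j}) = T \ {j} := by
    rw [← insert_sdiff_singleton_of_ne hji.symm, insert_sdiff_singleton, insert_eq_of_mem hiT]
  rw [e1, e2] at hle
  rw [circuitVec, if_pos hj.1.1, dual_circuitVec hE D hjD, add_comm, add_comm (μ.val (T \ {i}))]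
  exact hle

theorem dual_circuitVec_mem_cocircuits (hE : μ.toMatroid.E = univ) {B : Set α}
    (hB : μ.toMatroid.IsBase B) {i : α} (hi : i ∈ B) :
    μ.dual.circuitVec (insert i Bᶜ) ∈ μ.cocircuits := by
  have hiE : i ∈ μ.dual.toMatroid.E := show i ∈ μ.toMatroid.E from hE ▸ mem_univ i
  refine circuitVec_insert_mem_circuits (μ := μ.dual) ?_ hiE (by simpa using hi)
  change μ.toMatroid✶.IsBase Bᶜ
  rw [Matroid.dual_isBase_iff', hE]
  simpa [← compl_eq_univ_sdiff] using hB

theorem circuitOrthogonal_of_mem_cocircuits [Finite α] (hE : μ.toMatroid.E = univ)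
    {C : α → WithTop ℝ} (hC : C ∈ μ.cocircuits) : μ.CircuitOrthogonal C := by
  obtain ⟨⟨D, -, -, rfl⟩, -⟩ := hC
  rintro _ ⟨⟨T, -, -, rfl⟩, -⟩
  exact minTwice_circuitVec_add_dual hE T D

theorem CircuitOrthogonal.add_const {v : α → WithTop ℝ} (h : μ.CircuitOrthogonal v) (c : ℝ) :
    μ.CircuitOrthogonal fun i => v i + (c : WithTop ℝ) := by
  intro C hC
  simpa only [add_assoc] using (h C hC).add_const c

theorem CircuitOrthogonal.inf [Finite α] {ι : Type*} {s : Finset ι} {v : ι → α → WithTop ℝ}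
    (h : ∀ k ∈ s, μ.CircuitOrthogonal (v k)) :
    μ.CircuitOrthogonal fun i => s.inf fun k => v k i :=
  fun C hC => .add_inf fun k hk => h k hk C hC

/-- The fundamental cocircuit of `i` in a minimal base B has the entries μ(B − i + k). Minimality of
B says that v_k ≤ v_i − μ(B) + μ(B − i + k), with equality at k = i. -/
theorem MinBasesCover.exists_cocircuit [Fintype α] (hE : μ.toMatroid.E = univ) {J : Set α}
    {v : α → WithTop ℝ} (hJ : μ.toMatroid.IsBasis' J {i | v i = ⊤}) (h : μ.MinBasesCover J v)
    {i : α} (hi : v i ≠ ⊤) :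
    ∃ C ∈ μ.cocircuits, ∃ a : ℝ, (a : WithTop ℝ) + C i = v i ∧
      ∀ k, v k ≤ (a : WithTop ℝ) + C k := by
  obtain ⟨B, hB, hiB⟩ := h i hi
  have hDc : (insert i Bᶜ)ᶜ = B \ {i} := by
    ext x
    simp [and_comm]
  have hC : ∀ k ∈ insert i Bᶜ,
      μ.dual.circuitVec (insert i Bᶜ) k = μ.val (insert k (B \ {i})) := fun k hk => by
    rw [dual_circuitVec hE _ hk, hDc]
  have hCi : μ.dual.circuitVec (insert i Bᶜ) i = μ.realVal B := by
    rw [hC i (mem_insert _ _), insert_sdiff_singleton, insert_eq_of_mem hiB, coe_realVal hB.1]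
  refine ⟨_, dual_circuitVec_mem_cocircuits hE hB.1 hiB, realPart v i - μ.realVal B, ?_, ?_⟩
  · rw [hCi, ← coe_realPart hi, ← WithTop.coe_add, sub_add_cancel]
  · intro k
    by_cases hk : k ∈ insert i Bᶜ
    swap
    · simp [circuitVec, hk]
    rcases hk with rfl | hkB
    · rw [hCi, ← coe_realPart hi, ← WithTop.coe_add, sub_add_cancel]
    rw [hC k (Or.inr hkB)]
    by_cases hB1 : μ.toMatroid.IsBase (insert k (B \ {i}))
    swap
    · rw [not_ne_iff.1 (mt (μ.val_ne_top_iff _).1 hB1)]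
      simp
    have hJ1 : J ⊆ insert k (B \ {i}) := fun x hx =>
      Or.inr ⟨hB.2.1 hx, fun hxi => hi (hxi ▸ hJ.subset hx)⟩
    have hvk : v k ≠ ⊤ := fun hvk =>
      hkB (hB.2.1 (hJ.mem_of_insert_indep hvk
        (hB1.indep.subset (insert_subset (mem_insert _ _) hJ1))))
    have hmin := hB.2.2 _ hB1 hJ1
    rw [weight_exchange_eq _ hiB hkB, weight] at hmin
    rw [← coe_realVal hB1, ← coe_realPart hvk]
    norm_cast
    linarith

end ValuatedMatroid

/-! ### Representatives and topology of tropical projective space. -/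

section TropProj

variable {α : Type*}

theorem TropProj.exists_isRep (p : TropProj α) : ∃ v, p.IsRep v := by
  obtain ⟨⟨v, hv⟩, rfl⟩ := Quotient.exists_rep p
  exact ⟨v, hv, rfl⟩

theorem TropProj.IsRep.exists_add_const {p : TropProj α} {v w : α → WithTop ℝ} (hv : p.IsRep v)
    (hw : p.IsRep w) : ∃ c : ℝ, w = fun i => v i + (c : WithTop ℝ) := by
  obtain ⟨hv', rfl⟩ := hv
  obtain ⟨hw', h⟩ := hw
  obtain ⟨c, hc⟩ := Quotient.exact h
  exact ⟨c, funext hc⟩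

theorem extendTop_eq_top_iff {E : Set α} {u : E → ℝ} {i : α} : extendTop u i = ⊤ ↔ i ∉ E := by
  by_cases h : i ∈ E <;> simp [extendTop, h]

theorem extendTop_realPart {E : Set α} {v : α → WithTop ℝ} (h : ∀ i, v i = ⊤ ↔ i ∉ E) :
    extendTop (fun i : E => ValuatedMatroid.realPart v i) = v := by
  funext i
  by_cases hi : i ∈ E
  · simp only [extendTop, dif_pos hi]
    exact ValuatedMatroid.coe_realPart fun hv => (h i).1 hv hi
  · rw [(h i).2 hi, extendTop_eq_top_iff]
    exact hi

theorem exists_extendTop_eq_add_const {E : Set α} {u u' : E → ℝ}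
    (h : (Submodule.Quotient.mk u : TropTorus E) = Submodule.Quotient.mk u') :
    ∃ c : ℝ, extendTop u = fun i => extendTop u' i + (c : WithTop ℝ) := by
  rw [Submodule.Quotient.eq, Submodule.mem_span_singleton] at h
  obtain ⟨c, hc⟩ := h
  refine ⟨c, funext fun i => ?_⟩
  by_cases hi : i ∈ E
  · have := congrFun hc ⟨i, hi⟩
    simp only [Pi.smul_apply, Pi.one_apply, smul_eq_mul, mul_one, Pi.sub_apply] at this
    simp only [extendTop, dif_pos hi]
    norm_cast
    linarith
  · simp [extendTop, hi]

theorem continuous_const_add_withTop (c : WithTop ℝ) :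
    Continuous fun x : WithTop ℝ => c + x := by
  induction c with
  | top => simpa using continuous_const
  | coe c =>
    refine Monotone.continuous_of_surjective (fun x y h => add_le_add_right h _) fun y => ?_
    refine ⟨((-c : ℝ) : WithTop ℝ) + y, ?_⟩
    rw [← add_assoc, ← WithTop.coe_add]
    simp

theorem isClosed_setOf_minTwice [Finite α] : IsClosed {f : α → WithTop ℝ | MinTwice f} := by
  have : {f : α → WithTop ℝ | MinTwice f} = (⋂ i, {f | f i = ⊤}) ∪
      ⋃ i, ⋃ j, ({f | i ≠ j} ∩ ({f | f i = f j} ∩ ⋂ k, {f | f i ≤ f k})) := by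
    ext f
    simp [MinTwice]
  rw [this]
  refine (isClosed_iInter fun i => isClosed_eq (continuous_apply i) continuous_const).union
    (isClosed_iUnion_of_finite fun i => isClosed_iUnion_of_finite fun j => ?_)
  exact isClosed_const.inter ((isClosed_eq (continuous_apply i) (continuous_apply j)).inter
    (isClosed_iInter fun k => isClosed_le (continuous_apply i) (continuous_apply k)))

theorem mem_tropHyperplane_iff {C v : α → WithTop ℝ} {p : TropProj α} (hp : p.IsRep v) :
    p ∈ tropHyperplane C ↔ MinTwice fun i => C i + v i := by
  refine ⟨?_, fun h => ⟨v, hp, h⟩⟩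
  rintro ⟨w, hw, h⟩
  obtain ⟨c, rfl⟩ := hw.exists_add_const hp
  simpa only [add_assoc] using h.add_const c

theorem TropProj.continuous_mk :
    Continuous fun u : {v : α → WithTop ℝ // v ≠ ⊤} => TropProj.mk u.1 u.2 :=
  continuous_quotient_mk'

theorem isClosed_tropHyperplane [Finite α] (C : α → WithTop ℝ) : IsClosed (tropHyperplane C) := by
  refine (isQuotientMap_quot_mk (r := (tropSetoid α).r)).isClosed_preimage.1 ?_
  have : (Quot.mk (tropSetoid α).r ⁻¹' tropHyperplane C : Set {v : α → WithTop ℝ // v ≠ ⊤}) =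
      (fun u i => C i + u.1 i) ⁻¹' {f | MinTwice f} := by
    ext u
    exact mem_tropHyperplane_iff ⟨u.2, rfl⟩
  rw [this]
  refine isClosed_setOf_minTwice.preimage (continuous_pi fun i => ?_)
  exact (continuous_const_add_withTop (C i)).comp
    ((continuous_apply i).comp continuous_subtype_val)

end TropProj

namespace ValuatedMatroid

variable {α : Type*} {μ : ValuatedMatroid α}

theorem mem_circuitPrevariety_iff {v : α → WithTop ℝ} {p : TropProj α} (hp : p.IsRep v) :
    p ∈ μ.circuitPrevariety ↔ μ.CircuitOrthogonal v := by
  simp only [circuitPrevariety, mem_iInter, mem_tropHyperplane_iff hp, CircuitOrthogonal]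

/-! ### Contractions -/

/-- The two circuit vectors can differ only on S, where adding `v` makes both infinite. -/
theorem contract_circuitVec_add {v : α → WithTop ℝ} {S T : Set α} (hv : ∀ i, v i = ⊤ ↔ i ∈ S)
    (hT : Disjoint T S) (k : α) : (μ.contract S).circuitVec T k + v k =
      μ.circuitVec (T ∪ basisOf μ.toMatroid S) k + v k := by
  by_cases hk : k ∈ S
  · simp [(hv k).2 hk]
  have hkJ : k ∉ basisOf μ.toMatroid S := fun h => hk ((basisOf_spec _ _).subset h)
  congr 1
  by_cases hkT : k ∈ T
  · rw [circuitVec, circuitVec, if_pos hkT, if_pos (mem_union_left _ hkT), union_sdiff_distrib,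
      sdiff_singleton_eq_self hkJ]
    exact if_pos (hT.mono_left sdiff_subset)
  · rw [circuitVec, circuitVec, if_neg hkT, if_neg]
    exact fun h => h.elim hkT hkJ

theorem isBase_inter_eq_of_isBasis' {M : Matroid α} {B J S : Set α} (hB : M.IsBase B)
    (hJB : J ⊆ B) (hJ : M.IsBasis' J S) : B ∩ S = J := by
  refine subset_antisymm (fun x hx => ?_) (subset_inter hJB hJ.subset)
  exact hJ.mem_of_insert_indep hx.2 (hB.indep.subset (insert_subset hx.1 hJB))

/-- With J the chosen basis of S, the bases of `μ` containing J are the sets A ∪ J with A a base of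
the contraction. Their fundamental circuits suffice for the covering criterion. -/
theorem circuitOrthogonal_contract_iff [Fintype α] (hE : μ.toMatroid.E = univ) {S : Set α}
    {v : α → WithTop ℝ} (hv : ∀ i, v i = ⊤ ↔ i ∈ S) :
    (μ.contract S).CircuitOrthogonal v ↔ μ.CircuitOrthogonal v := by
  have hJ := basisOf_spec μ.toMatroid S
  have hS : {i | v i = ⊤} = S := ext hv
  constructor
  · intro h
    rw [circuitOrthogonal_iff_minBasesCover hE (J := basisOf μ.toMatroid S) (by rwa [hS])]
    refine minBasesCover_of_minTwice hJ.indep (fun i hi => (hv i).2 (hJ.subset hi)) ?_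
    intro B hB hJB i hiB hvi
    have hiS : i ∉ S := fun h => hvi ((hv i).2 h)
    have hd : Disjoint (B \ basisOf μ.toMatroid S) S := by
      rw [Set.disjoint_left]
      intro x hx hxS
      exact hx.2 ((isBase_inter_eq_of_isBasis' hB hJB hJ).subset ⟨hx.1, hxS⟩)
    have hBc : (μ.contract S).toMatroid.IsBase (B \ basisOf μ.toMatroid S) :=
      (contract_isBase_iff hJ).2 ⟨by rwa [sdiff_union_of_subset hJB], hd⟩
    have hiE : i ∈ (μ.contract S).toMatroid.E := ⟨hE ▸ mem_univ i, hiS⟩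
    have := h _ (circuitVec_insert_mem_circuits hBc hiE fun h => hiB h.1)
    simpa only [contract_circuitVec_add hv (disjoint_insert_left.2 ⟨hiS, hd⟩), insert_union,
      sdiff_union_of_subset hJB] using this
  · rintro h _ ⟨⟨T, hT, -, rfl⟩, -⟩
    have hd : Disjoint T S := Set.disjoint_left.2 fun x hx => (hT hx).2
    simpa only [contract_circuitVec_add hv hd] using h.minTwice hE (T ∪ basisOf μ.toMatroid S)

theorem mem_timesInfty_contract_trop_iff [Fintype α] (hE : μ.toMatroid.E = univ) {S : Set α}
    {p : TropProj α} {v : α → WithTop ℝ} (hp : p.IsRep v) :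
    p ∈ timesInfty (μ.contract S).trop ↔ {i | v i = ⊤} = S ∧ μ.CircuitOrthogonal v := by
  have hmem : ∀ i, i ∉ (μ.contract S).toMatroid.E ↔ i ∈ S := fun i => by
    change i ∉ μ.toMatroid.E \ S ↔ _
    simp [hE]
  constructor
  · rintro ⟨u, ⟨u', hu', hu⟩, hpu⟩
    obtain ⟨c, hc⟩ := hpu.exists_add_const hp
    obtain ⟨d, hd⟩ := exists_extendTop_eq_add_const hu.symm
    have hv : ∀ i, v i = ⊤ ↔ i ∈ S := fun i => by
      rw [hc, ← hmem i, ← extendTop_eq_top_iff (u := u)]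
      simp
    refine ⟨ext hv, (circuitOrthogonal_contract_iff hE hv).1 ?_⟩
    have hu'' : (μ.contract S).CircuitOrthogonal (extendTop u') := hu'
    rw [hc, hd]
    exact (hu''.add_const d).add_const c
  · rintro ⟨hS, h⟩
    have hv : ∀ i, v i = ⊤ ↔ i ∈ S := fun i => Set.ext_iff.1 hS i
    have hext := extendTop_realPart (E := (μ.contract S).toMatroid.E) (v := v) fun i =>
      (hv i).trans (hmem i).symm
    refine ⟨_, ⟨fun i => realPart v i, ?_, rfl⟩, hext.symm ▸ hp⟩
    change (μ.contract S).CircuitOrthogonal _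
    rw [hext]
    exact (circuitOrthogonal_contract_iff hE hv).2 h

theorem projTrop_eq_circuitPrevariety [Fintype α] (hE : μ.toMatroid.E = univ) :
    μ.projTrop = μ.circuitPrevariety := by
  ext p
  obtain ⟨v, hp⟩ := p.exists_isRep
  rw [mem_circuitPrevariety_iff hp]
  simp only [projTrop, mem_iUnion, mem_ofPred_eq, mem_timesInfty_contract_trop_iff hE hp]
  refine ⟨fun ⟨_, _, _, h⟩ => h, fun h => ⟨_, ?_, rfl, h⟩⟩
  rw [hE, ssubset_univ_iff]
  intro hv
  obtain ⟨hv', -⟩ := hp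
  exact hv' (funext fun i => hv.symm.subset (mem_univ i))

/-! ### Coloopless cells -/

theorem pairing_eq_sum_indicator [Fintype α] {E : Set α} (u : E → ℝ) {B : Set α} :
    pairing u B = ∑ i, B.indicator (realPart (extendTop u)) i := by
  classical
  rw [pairing]
  refine Fintype.sum_of_injective _ Subtype.val_injective _ _ (fun i hi => ?_) fun i => ?_
  · rw [indicator_apply_eq_zero]
    intro _
    -- Coordinates outside `E` are infinite, and the default value 0 of `realPart` removes them from
    -- the sum.
    rw [realPart, extendTop_eq_top_iff.2 (by simpa using hi)]
    rfl
  · by_cases hi : (i : α) ∈ B <;> simp [hi, realPart, extendTop]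

theorem face_eq_setOf_isMinBase [Fintype α] (u : μ.toMatroid.E → ℝ) :
    μ.face u = {B | μ.IsMinBase ∅ (-realPart (extendTop u)) B} := by
  have key : ∀ B, μ.toMatroid.IsBase B → (pairing u B : WithTop ℝ) + μ.val B =
      (μ.weight (-realPart (extendTop u)) B : ℝ) := fun B hB => by
    rw [← coe_realVal hB, pairing_eq_sum_indicator, ← WithTop.coe_add, weight]
    simp only [indicator_neg', Finset.sum_neg_distrib, Pi.neg_apply, sub_neg_eq_add]
    rw [add_comm]
  ext B
  simp only [face, IsMinBase, mem_ofPred_eq, empty_subset, true_and, forall_true_left]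
  refine and_congr_right fun hB => forall₂_congr fun B' hB' => ?_
  rw [key B hB, key B' hB', WithTop.coe_le_coe]

/-- When both bases are minimal, the weight exchange inequality forces both exchanged bases to be
minimal, so minimal bases satisfy the exchange axiom. -/
theorem exists_matroid_isBase_iff_isMinBase [Fintype α] (w : α → ℝ) :
    ∃ N : Matroid α, N.E = μ.toMatroid.E ∧ ∀ B, N.IsBase B ↔ μ.IsMinBase ∅ w B := by
  obtain ⟨B₀, hB₀⟩ := exists_isMinBase (μ := μ) μ.toMatroid.empty_indep w
  refine ⟨Matroid.ofExistsFiniteIsBase μ.toMatroid.E (μ.IsMinBase ∅ w) ⟨B₀, hB₀, toFinite _⟩ ?_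
    fun B hB => hB.1.subset_ground, rfl, fun B => Iff.rfl⟩
  intro B B' hB hB' i hi
  obtain ⟨j, hj, h1, h2, h⟩ := exists_isBase_weight_exchange w hB.1 hB'.1 hi
  refine ⟨j, hj, h1, empty_subset _, fun B'' hB'' hs => le_trans ?_ (hB.2.2 B'' hB'' hs)⟩
  have := hB'.2.2 _ h2 (empty_subset _)
  linarith

/-- Contracting `U` in the dual is dual to deleting `U`. The cobasis K chosen for the dual
restriction thus determines the basis J = Uᶜ \ K of the infinite set. The map D ↦ (D ∪ K)ᶜ then
matches bases of the dual restriction with bases of `μ` containing J. -/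
theorem isBasis'_compl_sdiff_cobasisOf (hE : μ.toMatroid.E = univ) (U : Set α) :
    μ.toMatroid.IsBasis' (Uᶜ \ cobasisOf μ.dual.toMatroid U) Uᶜ := by
  have h : (μ.toMatroid✶ ／ U).IsBase (cobasisOf μ.dual.toMatroid U) := cobasisOf_spec _ _
  rw [← Matroid.dual_delete, Matroid.dual_isBase_iff', Matroid.delete_eq_restrict,
    Matroid.isBase_restrict_iff', hE, ← compl_eq_univ_sdiff] at h
  exact h.1

theorem dual_restrict_isBase_iff (hE : μ.toMatroid.E = univ) (U : Set α) {D : Set α} : (μ.dual.restrict U).toMatroid.IsBase D ↔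
    D ⊆ U ∧ μ.toMatroid.IsBase (D ∪ cobasisOf μ.dual.toMatroid U)ᶜ := by
  change (μ.dual.toMatroid ↾ U).IsBase D ↔ _
  rw [restrict_isBase_iff (cobasisOf_spec _ _), and_comm]
  change _ ∧ (μ.toMatroid✶).IsBase _ ↔ _
  rw [Matroid.dual_isBase_iff', hE, ← compl_eq_univ_sdiff]
  simp

theorem dual_restrict_realVal (hE : μ.toMatroid.E = univ) (U : Set α) {D : Set α} (hD : D ⊆ U) : (μ.dual.restrict U).realVal D =
    μ.realVal (D ∪ cobasisOf μ.dual.toMatroid U)ᶜ := by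
  have : (μ.dual.restrict U).val D = μ.dual.val (D ∪ cobasisOf μ.dual.toMatroid U) := if_pos hD
  rw [realVal, this, realVal]
  simp only [dual, hE, subset_univ, if_true, compl_eq_univ_sdiff]

theorem dual_restrict_weight [Fintype α] (hE : μ.toMatroid.E = univ) (U : Set α) {v : α → WithTop ℝ} (hv : ∀ i, v i = ⊤ ↔ i ∉ U) {D : Set α}
    (hD : D ⊆ U) : (μ.dual.restrict U).weight (-realPart v) D =
      μ.weight (realPart v) (D ∪ cobasisOf μ.dual.toMatroid U)ᶜ + ∑ i, realPart v i := by
  -- The cobasis lies in the infinite set, so it contributes nothing. The sums over D and over the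
  -- complementary base then add up to the constant total.
  have hdis : ∀ i ∈ cobasisOf μ.dual.toMatroid U, realPart v i = 0 := fun i hi => by
    have : i ∉ U := ((cobasisOf_spec μ.dual.toMatroid U).subset_ground hi).2
    rw [realPart, (hv i).2 this]
    rfl
  have hsum : ∀ i, realPart v i = D.indicator (realPart v) i +
      (D ∪ cobasisOf μ.dual.toMatroid U)ᶜ.indicator (realPart v) i := fun i => by
    by_cases hi : i ∈ D
    · simp [hi]
    · by_cases hi' : i ∈ cobasisOf μ.dual.toMatroid U
      · simp [hi, hi', hdis i hi']
      · simp [hi, hi']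
  rw [weight, weight, dual_restrict_realVal hE U hD, Finset.sum_congr rfl fun i _ => hsum i,
    Finset.sum_add_distrib]
  simp only [indicator_neg', Finset.sum_neg_distrib, Pi.neg_apply]
  ring

/-- The inverse of the correspondence is B ↦ U \ B, since B meets Uᶜ exactly in its basis J. -/
theorem eq_compl_sdiff_union_cobasisOf (hE : μ.toMatroid.E = univ) (U : Set α) {B : Set α} (hB : μ.toMatroid.IsBase B)
    (hJB : Uᶜ \ cobasisOf μ.dual.toMatroid U ⊆ B) :
    B = ((U \ B) ∪ cobasisOf μ.dual.toMatroid U)ᶜ := by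
  have hi := isBase_inter_eq_of_isBasis' hB hJB (isBasis'_compl_sdiff_cobasisOf hE U)
  have hdis : ∀ i ∈ cobasisOf μ.dual.toMatroid U, i ∉ U := fun i hi =>
    ((cobasisOf_spec μ.dual.toMatroid U).subset_ground hi).2
  ext x
  have h1 := Set.ext_iff.1 hi x
  have h2 := hdis x
  simp only [mem_inter_iff, mem_compl_iff, mem_sdiff, mem_union] at h1 ⊢
  tauto

theorem isMinBase_dual_restrict_iff [Fintype α] (hE : μ.toMatroid.E = univ) (U : Set α)
    {v : α → WithTop ℝ} (hv : ∀ i, v i = ⊤ ↔ i ∉ U) {D : Set α} (hD : D ⊆ U) :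
    (μ.dual.restrict U).IsMinBase ∅ (-realPart v) D ↔
      μ.IsMinBase (Uᶜ \ cobasisOf μ.dual.toMatroid U) (realPart v)
        (D ∪ cobasisOf μ.dual.toMatroid U)ᶜ := by
  have hsub : ∀ {D : Set α}, D ⊆ U →
      Uᶜ \ cobasisOf μ.dual.toMatroid U ⊆ (D ∪ cobasisOf μ.dual.toMatroid U)ᶜ :=
    fun hD x hx h => h.elim (fun h => hx.1 (hD h)) hx.2
  simp only [IsMinBase, dual_restrict_isBase_iff hE, hD, true_and, empty_subset, hsub,
    forall_true_left, and_imp]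
  refine and_congr_right fun _ => ⟨fun h B' hB' hJB' => ?_, fun h D' hD' hB' => ?_⟩
  · have he := eq_compl_sdiff_union_cobasisOf hE U hB' hJB'
    have := h (U \ B') sdiff_subset (he ▸ hB')
    rw [dual_restrict_weight hE U hv hD, dual_restrict_weight hE U hv sdiff_subset, ← he] at this
    linarith
  · rw [dual_restrict_weight hE U hv hD, dual_restrict_weight hE U hv hD']
    have := h _ hB' (hsub hD')
    linarith

/-- An element of `U` is not a coloop of the face when some minimal dual base avoids it, that is,
when the complementary minimal base of `μ` contains it. This is the covering criterion. -/
theorem isColooplessBaseSet_face_iff [Fintype α] (hE : μ.toMatroid.E = univ) {U : Set α}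
    (u : U → ℝ) : IsColooplessBaseSet U ((μ.dual.restrict U).face u) ↔
      μ.CircuitOrthogonal (extendTop u) := by
  have hv : ∀ i, extendTop u i = ⊤ ↔ i ∉ U := fun i => extendTop_eq_top_iff
  have hJ : μ.toMatroid.IsBasis' (Uᶜ \ cobasisOf μ.dual.toMatroid U) {i | extendTop u i = ⊤} := by
    have : {i | extendTop u i = ⊤} = Uᶜ := ext hv
    rw [this]
    exact isBasis'_compl_sdiff_cobasisOf hE U
  rw [circuitOrthogonal_iff_minBasesCover hE hJ]
  have hface : ∀ D, D ∈ (μ.dual.restrict U).face u ↔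
      (μ.dual.restrict U).IsMinBase ∅ (-realPart (extendTop u)) D := fun D =>
    Set.ext_iff.1 (face_eq_setOf_isMinBase (μ := μ.dual.restrict U) u) D
  constructor
  · rintro ⟨N, hNE, hN, hcol⟩ i hi
    have hiU : i ∈ U := by
      by_contra h
      exact hi ((hv i).2 h)
    have := hcol i
    rw [Matroid.isColoop_iff_forall_mem_isBase] at this
    push Not at this
    obtain ⟨D, hD, hiD⟩ := this
    have hDU : D ⊆ U := hNE ▸ hD.subset_ground
    refine ⟨_, (isMinBase_dual_restrict_iff hE U hv hDU).1 ((hface D).1 ((hN D).1 hD)), ?_⟩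
    exact fun h => h.elim hiD fun h => ((cobasisOf_spec μ.dual.toMatroid U).subset_ground h).2 hiU
  · intro h
    obtain ⟨N, hNE, hN⟩ := exists_matroid_isBase_iff_isMinBase (μ := μ.dual.restrict U)
      (-realPart (extendTop u))
    refine ⟨N, hNE, fun B => (hN B).trans (hface B).symm, fun e he => ?_⟩
    have heU : e ∈ U := (show N.E = U from hNE) ▸ he.mem_ground
    obtain ⟨B, hB, heB⟩ := h e fun h => (hv e).1 h heU
    rw [eq_compl_sdiff_union_cobasisOf hE U hB.1 hB.2.1,
      ← isMinBase_dual_restrict_iff hE U hv sdiff_subset, ← hN] at hB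
    exact (Matroid.isColoop_iff_forall_mem_isBase.1 he hB).2 heB

theorem dual_colooplessCells_eq_circuitPrevariety [Fintype α] (hE : μ.toMatroid.E = univ) :
    μ.dual.colooplessCells = μ.circuitPrevariety := by
  ext p
  constructor
  · rintro ⟨U, u, hp, h⟩
    exact (mem_circuitPrevariety_iff hp).2 ((isColooplessBaseSet_face_iff hE u).1 h)
  · intro h
    obtain ⟨v, hp⟩ := p.exists_isRep
    have hext := extendTop_realPart (E := {i | v i ≠ ⊤}) (v := v) fun i => by simp
    refine ⟨{i | v i ≠ ⊤}, fun i => realPart v i, hext.symm ▸ hp, ?_⟩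
    rw [isColooplessBaseSet_face_iff hE, hext]
    exact (mem_circuitPrevariety_iff hp).1 h

/-! ### The span of the cocircuits -/

theorem tropSpan_cocircuits_eq_circuitPrevariety [Fintype α] (hE : μ.toMatroid.E = univ) :
    tropSpan μ.cocircuits = μ.circuitPrevariety := by
  ext p
  constructor
  · rintro ⟨m, C, a, hC, hp⟩
    rw [mem_circuitPrevariety_iff hp]
    refine CircuitOrthogonal.inf fun k _ => ?_
    simpa only [add_comm] using (circuitOrthogonal_of_mem_cocircuits hE (hC k)).add_const (a k)
  · intro h
    obtain ⟨v, hp⟩ := p.exists_isRep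
    rw [mem_circuitPrevariety_iff hp] at h
    have hJ := basisOf_spec μ.toMatroid {i | v i = ⊤}
    choose C hC a ha hle using fun i : {i | v i ≠ ⊤} =>
      ((circuitOrthogonal_iff_minBasesCover hE hJ).1 h).exists_cocircuit hE hJ i.2
    classical
    have e := Fintype.equivFin {i | v i ≠ ⊤}
    refine ⟨_, fun k => C (e.symm k), fun k => a (e.symm k), fun k => hC _, ?_⟩
    convert hp using 1
    funext i
    -- Each scaled cocircuit dominates `v`, and the one chosen for a finite coordinate attains it
    -- there.
    refine le_antisymm ?_ (Finset.le_inf fun k _ => hle _ i)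
    by_cases hi : v i = ⊤
    · simp [hi]
    · refine (Finset.inf_le (Finset.mem_univ (e ⟨i, hi⟩))).trans ?_
      beta_reduce
      rw [e.symm_apply_apply]
      exact (ha ⟨i, hi⟩).le

/-! ### The closure of the stratum of largest support -/

theorem CircuitOrthogonal.eq_top_of_isLoop [Fintype α] (hE : μ.toMatroid.E = univ)
    {v : α → WithTop ℝ} (h : μ.CircuitOrthogonal v) {i : α} (hi : μ.toMatroid.IsLoop i) :
    v i = ⊤ := by
  by_contra hvi
  obtain ⟨B, hB, hiB⟩ :=
    (circuitOrthogonal_iff_minBasesCover hE (basisOf_spec _ _)).1 h i hvi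
  exact (hB.1.indep.isNonloop_of_mem hiB).not_isLoop hi

/-- The infimum of one cocircuit through each nonloop is finite at every nonloop, while
orthogonality forces ∞ at the loops. -/
theorem exists_circuitOrthogonal_eq_top_iff_isLoop [Fintype α] (hE : μ.toMatroid.E = univ) :
    ∃ w : α → WithTop ℝ, μ.CircuitOrthogonal w ∧ ∀ i, w i = ⊤ ↔ μ.toMatroid.IsLoop i := by
  classical
  have hC : ∀ i : {i | ¬ μ.toMatroid.IsLoop i}, ∃ C ∈ μ.cocircuits, C i ≠ ⊤ := by
    rintro ⟨i, hi⟩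
    obtain ⟨B, hB, hiB⟩ := Matroid.IsNonloop.exists_mem_isBase ⟨hi, hE ▸ mem_univ i⟩
    refine ⟨_, dual_circuitVec_mem_cocircuits hE hB hiB, ?_⟩
    rw [dual_circuitVec hE _ (mem_insert _ _), μ.val_ne_top_iff]
    convert hB using 1
    ext x
    by_cases hx : x = i <;> simp [hx, hiB]
  choose C hC hCi using hC
  have hw : μ.CircuitOrthogonal fun i => Finset.univ.inf fun k => C k i :=
    .inf fun k _ => circuitOrthogonal_of_mem_cocircuits hE (hC k)
  refine ⟨_, hw, fun i => ⟨fun h => ?_, hw.eq_top_of_isLoop hE⟩⟩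
  by_contra hi
  refine hCi ⟨i, hi⟩ (top_le_iff.1 (h.ge.trans ?_))
  exact Finset.inf_le (f := fun k => C k i)
    (Finset.mem_univ (⟨i, hi⟩ : {i | ¬ μ.toMatroid.IsLoop i}))

theorem tendsto_min_add_coe_atTop (a b : WithTop ℝ) (h : b = ⊤ → a = ⊤) :
    Filter.Tendsto (fun t : ℕ => min a (b + ((t : ℝ) : WithTop ℝ))) Filter.atTop (nhds a) := by
  induction b with
  | top => simp
  | coe b =>
    rw [tendsto_order]
    refine ⟨fun x hx => ?_, fun x hx => .of_forall fun t => (min_le_left _ _).trans_lt hx⟩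
    obtain ⟨r, rfl⟩ := WithTop.ne_top_iff_exists.1 hx.ne_top
    filter_upwards [(tendsto_natCast_atTop_atTop (R := ℝ)).eventually_gt_atTop (r - b)] with t ht
    refine lt_min hx ?_
    norm_cast
    linarith

theorem CircuitOrthogonal.min [Finite α] {v w : α → WithTop ℝ} (hv : μ.CircuitOrthogonal v)
    (hw : μ.CircuitOrthogonal w) : μ.CircuitOrthogonal fun i => min (v i) (w i) := by
  have := CircuitOrthogonal.inf (μ := μ) (s := Finset.univ) (v := fun b : Bool => cond b v w)
    (by rintro (_ | _) -; exacts [hw, hv])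
  simpa using this

theorem closure_timesInfty_contract_loops [Fintype α] (hE : μ.toMatroid.E = univ) :
    closure (timesInfty (μ.contract μ.toMatroid.loops).trop) = μ.circuitPrevariety := by
  refine subset_antisymm (closure_minimal (fun p hp => ?_) ?_) fun p h => ?_
  · obtain ⟨v, hv⟩ := p.exists_isRep
    exact (mem_circuitPrevariety_iff hv).2 ((mem_timesInfty_contract_trop_iff hE hv).1 hp).2
  · exact isClosed_biInter fun C _ => isClosed_tropHyperplane C
  obtain ⟨v, hp⟩ := p.exists_isRep
  rw [mem_circuitPrevariety_iff hp] at h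
  obtain ⟨w, hw, hwi⟩ := exists_circuitOrthogonal_eq_top_iff_isLoop hE
  obtain ⟨hv, rfl⟩ := hp
  -- Each approximant is orthogonal and, because of `w`, infinite only at loops, so it lies in the
  -- stratum of largest support. As t grows, the second term exceeds every real bound at the
  -- nonloops and the minimum tends to `v`, also where `v` is infinite.
  let f : ℕ → α → WithTop ℝ := fun t i => min (v i) (w i + ((t : ℝ) : WithTop ℝ))
  have hf : ∀ t, f t ≠ ⊤ := fun t ht =>
    hv (top_le_iff.1 (ht.ge.trans fun i => min_le_left _ _))
  have htend : Filter.Tendsto (fun t => (⟨f t, hf t⟩ : {v : α → WithTop ℝ // v ≠ ⊤})) Filter.atTop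
      (nhds ⟨v, hv⟩) := by
    rw [tendsto_subtype_rng, tendsto_pi_nhds]
    exact fun i => tendsto_min_add_coe_atTop _ _ fun hi => h.eq_top_of_isLoop hE ((hwi i).1 hi)
  refine mem_closure_of_tendsto ((TropProj.continuous_mk.tendsto _).comp htend)
    (.of_forall fun t => ?_)
  refine (mem_timesInfty_contract_trop_iff hE ⟨hf t, rfl⟩).2 ⟨?_, h.min (hw.add_const t)⟩
  ext i
  change min (v i) (w i + ((t : ℝ) : WithTop ℝ)) = ⊤ ↔ μ.toMatroid.IsLoop i
  simp only [min_eq_top, WithTop.add_eq_top, WithTop.coe_ne_top, or_false, hwi]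
  exact ⟨And.right, fun hi => ⟨h.eq_top_of_isLoop hE hi, hi⟩⟩

end ValuatedMatroid

theorem theoremB {n : ℕ} (μ : ValuatedMatroid (Fin n)) (hE : μ.toMatroid.E = Set.univ) :
    μ.projTrop = μ.circuitPrevariety ∧
    μ.projTrop = μ.dual.colooplessCells ∧
    μ.projTrop = tropSpan μ.cocircuits ∧
    μ.projTrop = closure (timesInfty (μ.contract μ.toMatroid.loops).trop) := by
  rw [ValuatedMatroid.projTrop_eq_circuitPrevariety hE,
    ValuatedMatroid.dual_colooplessCells_eq_circuitPrevariety hE,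
    ValuatedMatroid.tropSpan_cocircuits_eq_circuitPrevariety hE,
    ValuatedMatroid.closure_timesInfty_contract_loops hE]
  exact ⟨rfl, rfl, rfl, rfl⟩
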